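/- Let $n\ge 2$, let $A>0$ be a real number, let $U\subset\mathbb R^n$ be open, and let $K\subset U$ be compact. Then there is an integer $N$ such that every tropical curve $G$ in $U$ with tropical area at most $A$ has at most $N$ vertices lying in $K$. Here a tropical curve $G$ in $U$ is a finite one-dimensional polyhedral complex in $U$, closed in $U$, with weights on its edges, as follows. It consists of a finite set of points of $U$, the vertices, and a finite set of edges. Each edge is a nondegenerate straight segment, ray or line in $U$, closed in $U$, and its ends may lie on the boundary of $U$ or at infinity. The vertices lying on an edge are exactly those endpoints of the edge that lie in $U$, and two distinct edges meet only in vertices. Every vertex is an endpoint of at least three edges. Each edge $e$ carries a weight $w_e\in(\mathbb Z^n\setminus\{0\})/\{\pm1\}$ parallel to $e$, and the balancing condition holds: for each vertex $v$, $\sum_{e\ni v}\widetilde w_e=0$, where the sum is over all edges having $v$ as an endpoint and $\widetilde w_e$ is the representative of $w_e$ pointing outwards from $v$. The tropical area of $G$ is $\sum_e |e|\cdot|w_e|\in[0,\infty]$, the sum over all edges, where $|e|$ is the Euclidean length of $e$ and $|w_e|$ is the Euclidean norm of a representative of $w_e$. -/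

import Mathlib

/-- A nonzero integer vector in `ℤⁿ`. -/
abbrev NonzeroIntVec (n : ℕ) : Type := {u : Fin n → ℤ // u ≠ 0}

/-- Two nonzero integer vectors are identified when they agree up to sign. -/
def signSetoid (n : ℕ) : Setoid (NonzeroIntVec n) where
  r u v := u.1 = v.1 ∨ u.1 = -v.1
  iseqv :=
    { refl := fun _ => Or.inl rfl
      symm := by
        rintro u v (h | h)
        · exact Or.inl h.symm
        · exact Or.inr (by rw [h, neg_neg])
      trans := by
        rintro u v w (h | h) (h' | h')
        · exact Or.inl (h.trans h')
        · exact Or.inr (h.trans h')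
        · exact Or.inr (by rw [h, h'])
        · exact Or.inl (by rw [h, h', neg_neg]) }

/-- The set `W = (ℤⁿ ∖ 0) / ±1` of weights. -/
def Weight (n : ℕ) : Type := Quotient (signSetoid n)

/-- The integer vector `u` is one of the two representatives of the weight `w`. -/
def Weight.IsRep {n : ℕ} (w : Weight n) (u : Fin n → ℤ) : Prop :=
  ∃ h : u ≠ 0, (Quotient.mk (signSetoid n) ⟨u, h⟩ : Weight n) = w

/-- The Euclidean norm of a weight, computed on either representative. -/
noncomputable def Weight.norm {n : ℕ} (w : Weight n) : ℝ :=
  Quotient.lift (s := signSetoid n) (fun u : NonzeroIntVec n => √(∑ i, (u.1 i : ℝ) ^ 2))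
    (by rintro u v (h | h) <;> simp [h]) w

/-- An integer vector, seen in Euclidean space. -/
noncomputable def intVec {n : ℕ} (u : Fin n → ℤ) : EuclideanSpace ℝ (Fin n) :=
  WithLp.toLp 2 (fun i => (u i : ℝ))

/-- The set `e` is parallel to the weight `w`: differences of points of `e` are real multiples
of the representatives of `w`. -/
def Weight.IsParallel {n : ℕ} (w : Weight n) (e : Set (EuclideanSpace ℝ (Fin n))) : Prop :=
  ∀ u, w.IsRep u → ∀ x ∈ e, ∀ y ∈ e, ∃ t : ℝ, y - x = t • intVec u

/-- The integer vector `u` points from `v` into `e`. -/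
def PointsOutward {n : ℕ} (v : EuclideanSpace ℝ (Fin n)) (e : Set (EuclideanSpace ℝ (Fin n)))
    (u : Fin n → ℤ) : Prop :=
  ∃ x ∈ e, ∃ t : ℝ, 0 < t ∧ x - v = t • intVec u

open scoped Classical in
/-- A tropical curve in `U`: a finite one-dimensional polyhedral complex in `U`, closed in `U`,
with at least 3-valent vertices, weighted and balanced.

An edge is recorded as the set of its points lying in `U`: a nondegenerate convex subset of a line,
relatively closed in `U`. Its endpoints in `U` are its extreme points; an end that is not in `U`
(because it lies on the boundary of `U` or at infinity) is not a point of the edge. -/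
structure TropicalCurve {n : ℕ} (U : Set (EuclideanSpace ℝ (Fin n))) where
  /-- the 0-dimensional faces -/
  vertices : Finset (EuclideanSpace ℝ (Fin n))
  /-- the 1-dimensional faces -/
  edges : Finset (Set (EuclideanSpace ℝ (Fin n)))
  /-- the weight of each edge -/
  weight : edges → Weight n
  vertex_mem : ∀ v ∈ vertices, v ∈ U
  edge_subset : ∀ e ∈ edges, e ⊆ U
  edge_convex : ∀ e ∈ edges, Convex ℝ e
  edge_nontrivial : ∀ e ∈ edges, e.Nontrivial
  /-- each edge is closed in `U` (hence so is the whole curve) -/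
  edge_closed : ∀ e ∈ edges, closure e ∩ U ⊆ e
  /-- the vertices on an edge are exactly its endpoints in `U` -/
  edge_endpoints : ∀ e ∈ edges, e ∩ ↑vertices = e.extremePoints ℝ
  /-- distinct edges meet only in vertices -/
  edge_inter : ∀ e ∈ edges, ∀ e' ∈ edges, e ≠ e' → e ∩ e' ⊆ ↑vertices
  /-- each vertex is at least 3-valent -/
  valence : ∀ v ∈ vertices, 3 ≤ (edges.filter (fun e => v ∈ e)).card
  weight_parallel : ∀ e : edges, (weight e).IsParallel e.1
  /-- the outward representatives of the weights of the edges at a vertex sum to zero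
  (`r e` is uniquely determined on those edges) -/
  balancing : ∀ v ∈ vertices, ∃ r : edges → (Fin n → ℤ),
    (∀ e : edges, v ∈ e.1 → (weight e).IsRep (r e) ∧ PointsOutward v e.1 (r e)) ∧
      ∑ e : edges with v ∈ e.1, r e = 0

/-- The tropical area: the sum over the edges of Euclidean length times norm of the weight. The
length of an edge, a convex subset of a line, is its diameter; it may be infinite. -/
noncomputable def TropicalCurve.area {n : ℕ} {U : Set (EuclideanSpace ℝ (Fin n))}
    (G : TropicalCurve U) : ENNReal :=
  ∑ e : G.edges, Metric.ediam e.1 * ENNReal.ofReal (G.weight e).norm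

/-! The number of vertices in a ball is controlled by a Bézout-type estimate. Project the curve to a
plane by `(X, x_j)`, with `X` a generic functional close to the coordinate `x_i`. The image is a
balanced planar graph whose edges may cross. For two edges over a common abscissa, take the sign of
their height difference times the determinant of their weight vectors, and sum over all pairs.
Between vertices this sum does not decrease, since a crossing can only raise it. At a vertex, pairs
with only one incident edge contribute no jump, by balancing, while pairs ending or starting there
together raise the sum by the absolute value of their determinant. The sum is bounded at the two
extremes by the determinants of the unbounded ends, which bounds the total over all vertices
(`planar_balanced_graph_inequality`, `TropicalCurve.sum_det_vertices_le`).

At a vertex of valence at least three, some two edges on the same side have a nonzero minor for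
suitable `i`, `j` (`TropicalCurve.exists_independent_edges`). Minors are integers, so every vertex
contributes at least `1 / 2` even after perturbing `x_i` to `X`. The ends come from edges crossing
the sphere, so the vertex count is at most a constant times the square of the weight crossing it
(`TropicalCurve.card_vertices_ball_le`). Averaging over radii finds a sphere where this weight is
bounded by the area (`TropicalCurve.exists_radius_sum_norm_le`), and finitely many balls cover `K`.
-/

/-! ### The planar Bézout-type inequality -/

/-- The sign of an affine function times a positive multiple of its slope is nondecreasing. -/
lemma sign_affine_mul_slope_mono {κ μ γ x y : ℝ} (hκ : 0 ≤ κ) (hxy : x ≤ y) :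
    Real.sign (μ * x + γ) * (κ * μ) ≤ Real.sign (μ * y + γ) * (κ * μ) := by
  have sign_mono : ∀ s t : ℝ, s ≤ t → Real.sign s ≤ Real.sign t := by
    intro s t hst
    unfold Real.sign
    split_ifs <;> linarith
  rcases le_total 0 μ with hμ | hμ
  · exact mul_le_mul_of_nonneg_right
      (sign_mono _ _ (by linarith [mul_le_mul_of_nonneg_left hxy hμ])) (mul_nonneg hκ hμ)
  · exact mul_le_mul_of_nonpos_right
      (sign_mono _ _ (by linarith [mul_le_mul_of_nonpos_left hxy hμ]))
      (mul_nonpos_of_nonneg_of_nonpos hκ hμ)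

lemma abs_sign_mul_le (x d : ℝ) : |Real.sign x * d| ≤ |d| := by
  rcases Real.sign_apply_eq x with h | h | h <;> simp [h]

lemma sign_affine_mul_slope_of_gt {κ μ γ x s : ℝ} (hκ : 0 ≤ κ) (hs : μ * s + γ = 0) (hx : s < x) :
    Real.sign (μ * x + γ) * (κ * μ) = |κ * μ| := by
  have h : μ * x + γ = μ * (x - s) := by linarith
  rw [h, abs_mul, abs_of_nonneg hκ]
  rcases lt_trichotomy μ 0 with hμ | rfl | hμ
  · rw [Real.sign_of_neg (mul_neg_of_neg_of_pos hμ (sub_pos.2 hx)), abs_of_neg hμ]; ring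
  · simp
  · rw [Real.sign_of_pos (mul_pos hμ (sub_pos.2 hx)), abs_of_pos hμ]; ring

lemma sign_affine_mul_slope_of_lt {κ μ γ x s : ℝ} (hκ : 0 ≤ κ) (hs : μ * s + γ = 0) (hx : x < s) :
    Real.sign (μ * x + γ) * (κ * μ) = -|κ * μ| := by
  have h : μ * x + γ = μ * (x - s) := by linarith
  rw [h, abs_mul, abs_of_nonneg hκ]
  rcases lt_trichotomy μ 0 with hμ | rfl | hμ
  · rw [Real.sign_of_pos (mul_pos_of_neg_of_neg hμ (sub_neg.2 hx)), abs_of_neg hμ]; ring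
  · simp
  · rw [Real.sign_of_neg (mul_neg_of_pos_of_neg hμ (sub_neg.2 hx)), abs_of_pos hμ]; ring

open scoped Classical in
/-- A Bézout-type inequality for a balanced planar graph. The edge `e` is the graph of
`x ↦ m e * x + c e` over the interval from `l e` to `r e`, with weight vector `a e • (1, m e)`.
Over each `s ∈ S` there is exactly one vertex, where the edges are balanced;
the remaining ends of edges are at `p` on the left and at `q` on the right. -/
theorem planar_balanced_graph_inequality {E : Type*} [Fintype E] (a m c l r : E → ℝ)
    (S : Finset ℝ) (p q : ℝ)
    (ha : ∀ e, 0 ≤ a e) (hlr : ∀ e, l e < r e)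
    (hl : ∀ e, l e = p ∨ l e ∈ S) (hr : ∀ e, r e = q ∨ r e ∈ S)
    (hp : ∀ s ∈ S, p < s) (hq : ∀ s ∈ S, s < q)
    (hy : ∀ s ∈ S, ∃ y, ∀ e, l e = s ∨ r e = s → m e * s + c e = y)
    (hbal : ∀ s ∈ S, ∑ e with r e = s, a e = ∑ e with l e = s, a e)
    (hbal' : ∀ s ∈ S, ∑ e with r e = s, a e * m e = ∑ e with l e = s, a e * m e) :
    ∑ s ∈ S, ∑ e, ∑ e', ((if l e = s ∧ l e' = s then |a e * a e' * (m e' - m e)| else 0) +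
        (if r e = s ∧ r e' = s then |a e * a e' * (m e' - m e)| else 0)) ≤
      ∑ e, ∑ e', ((if l e = p ∧ l e' = p then |a e * a e' * (m e' - m e)| else 0) +
        (if r e = q ∧ r e' = q then |a e * a e' * (m e' - m e)| else 0)) := by
  set D : E → E → ℝ := fun e e' => a e * a e' * (m e' - m e) with hD
  -- Here `D e e'` is the determinant of the two weight vectors. The height difference has slope `m
  -- e' - m e`, of the same sign as `D` when `D ≠ 0`, so `φ` can only jump upwards.
  set φ : E → E → ℝ → ℝ := fun e e' x =>
    Real.sign ((m e' - m e) * x + (c e' - c e)) * D e e' with hφ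
  have hDsymm : ∀ e e', D e' e = - D e e' := fun e e' => by simp only [hD]; ring
  have hφsymm : ∀ e e' x, φ e' e x = φ e e' x := by
    intro e e' x
    simp only [hφ]
    rw [hDsymm e e', show (m e - m e') * x + (c e - c e') =
      -((m e' - m e) * x + (c e' - c e)) by ring, Real.sign_neg]
    ring
  have hκ : ∀ e e', 0 ≤ a e * a e' := fun e e' => mul_nonneg (ha e) (ha e')
  have hmono : ∀ e e' x y, x ≤ y → φ e e' x ≤ φ e e' y := fun e e' x y h =>
    sign_affine_mul_slope_mono (hκ e e') h
  -- Bookkeeping for the ends of the interval over which both edges live. `Rs` and `Ls` treat edges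
  -- ending together: at a vertex the adjacent value of `φ` is exactly `∓|D|`, at `q` or `p` it is
  -- only bounded by `|D|`. `PR` and `PL` treat an end of `e` over which `e'` passes.
  set Rs : E → E → ℝ := fun e e' =>
    if r e = r e' then (if r e = q then |D e e'| else -|D e e'|) else 0 with hRs
  set Ls : E → E → ℝ := fun e e' =>
    if l e = l e' then (if l e = p then -|D e e'| else |D e e'|) else 0 with hLs
  set PR : E → E → ℝ := fun e e' => if l e' < r e ∧ r e < r e' then φ e e' (r e) else 0 with hPR
  set PL : E → E → ℝ := fun e e' => if l e' < l e ∧ l e < r e' then φ e e' (l e) else 0 with hPL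
  have hmeet : ∀ s ∈ S, ∀ e e', (l e = s ∨ r e = s) → (l e' = s ∨ r e' = s) →
      (m e' - m e) * s + (c e' - c e) = 0 := by
    intro s hs e e' h h'
    obtain ⟨y, hy⟩ := hy s hs
    linarith [hy e h, hy e' h']
  -- Monotonicity of `φ` from the left to the right end of the common interval; all terms vanish if
  -- there is no overlap.
  have key : ∀ e e', Ls e e' + PL e e' + PL e' e ≤ Rs e e' + PR e e' + PR e' e := by
    intro e e'
    rcases le_or_gt (min (r e) (r e')) (max (l e) (l e')) with hdis | hov
    · have h1 := hlr e
      have h2 := hlr e'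
      have : r e ≤ l e' ∨ r e' ≤ l e := by
        rcases min_le_iff.1 hdis with h | h <;> rcases le_max_iff.1 h with h | h
        · linarith
        · exact Or.inl h
        · exact Or.inr h
        · linarith
      simp only [hLs, hRs, hPL, hPR]
      rcases this with h | h
      · rw [if_neg (by intro h; linarith), if_neg (by intro h; linarith [h.1, h.2]),
          if_neg (by intro h; linarith [h.1, h.2]), if_neg (by intro h; linarith),
          if_neg (by intro h; linarith [h.1, h.2]), if_neg (by intro h; linarith [h.1, h.2])]
      · rw [if_neg (by intro h; linarith), if_neg (by intro h; linarith [h.1, h.2]),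
          if_neg (by intro h; linarith [h.1, h.2]), if_neg (by intro h; linarith),
          if_neg (by intro h; linarith [h.1, h.2]), if_neg (by intro h; linarith [h.1, h.2])]
    · have h12 : l e < r e' := (le_max_left _ _).trans_lt (hov.trans_le (min_le_right _ _))
      have h21 : l e' < r e := (le_max_right _ _).trans_lt (hov.trans_le (min_le_left _ _))
      have h1 := hlr e
      have h2 := hlr e'
      obtain ⟨x, hx1, hx2⟩ := exists_between hov
      obtain ⟨hx1, hx1'⟩ := max_lt_iff.1 hx1
      obtain ⟨hx2, hx2'⟩ := lt_min_iff.1 hx2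
      have habs := abs_le.1 (abs_sign_mul_le ((m e' - m e) * x + (c e' - c e)) (D e e'))
      have hleft : Ls e e' + PL e e' + PL e' e ≤ φ e e' x := by
        simp only [hLs, hPL]
        rcases lt_trichotomy (l e) (l e') with h | h | h
        · rw [if_neg h.ne, if_neg (by intro h'; linarith [h'.1]), if_pos ⟨h, h21⟩, hφsymm e e']
          linarith [hmono e e' _ _ hx1'.le]
        · rw [if_pos h, if_neg (fun h' : l e' < l e ∧ l e < r e' => by linarith [h'.1]),
            if_neg (fun h' : l e < l e' ∧ l e' < r e => by linarith [h'.1])]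
          split_ifs with hlp
          · linarith [habs.1]
          · have hs := (hl e).resolve_left hlp
            have : φ e e' x = |D e e'| := sign_affine_mul_slope_of_gt (hκ e e')
              (hmeet _ hs e e' (Or.inl rfl) (Or.inl h.symm)) hx1
            linarith
        · rw [if_neg h.ne', if_pos ⟨h, h12⟩, if_neg (by intro h'; linarith [h'.1])]
          linarith [hmono e e' _ _ hx1.le]
      have hright : φ e e' x ≤ Rs e e' + PR e e' + PR e' e := by
        simp only [hRs, hPR]
        rcases lt_trichotomy (r e) (r e') with h | h | h
        · rw [if_neg h.ne, if_pos ⟨h21, h⟩, if_neg (by intro h'; linarith [h'.2])]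
          linarith [hmono e e' _ _ hx2.le]
        · rw [if_pos h, if_neg (fun h' : l e' < r e ∧ r e < r e' => by linarith [h'.2]),
            if_neg (fun h' : l e < r e' ∧ r e' < r e => by linarith [h'.2])]
          split_ifs with hlp
          · linarith [habs.2]
          · have hs := (hr e).resolve_left hlp
            have : φ e e' x = -|D e e'| := sign_affine_mul_slope_of_lt (hκ e e')
              (hmeet _ hs e e' (Or.inr rfl) (Or.inr h.symm)) hx2
            linarith
        · rw [if_neg h.ne', if_neg (by intro h'; linarith [h'.2]), if_pos ⟨h12, h⟩, hφsymm e e']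
          linarith [hmono e e' _ _ hx2'.le]
      exact hleft.trans hright
  have hrq : ∀ e, r e ≤ q := fun e => (hr e).elim le_of_eq fun h => (hq _ h).le
  have hlp : ∀ e, p ≤ l e := fun e => (hl e).elim (fun h => h.ge) fun h => (hp _ h).le
  -- Balancing makes the sum continuous across a vertex for pairs with one passing edge. No edge
  -- passes over `q` or `p`, so only ends in `S` matter.
  have hpass : ∑ e, ∑ e', PR e e' = ∑ e, ∑ e', PL e e' := by
    rw [Finset.sum_comm, Finset.sum_comm (f := fun e e' => PL e e')]
    refine Finset.sum_congr rfl fun e' _ => ?_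
    have hPR' : ∀ e, PR e e' = ∑ s ∈ S, if r e = s then PR e e' else 0 := by
      intro e
      rw [Finset.sum_ite_eq]
      split_ifs with h
      · rfl
      · have := (hr e).resolve_right h
        simp only [hPR]
        exact if_neg (by intro h'; linarith [h'.2, hrq e'])
    have hPL' : ∀ e, PL e e' = ∑ s ∈ S, if l e = s then PL e e' else 0 := by
      intro e
      rw [Finset.sum_ite_eq]
      split_ifs with h
      · rfl
      · have := (hl e).resolve_right h
        simp only [hPL]
        exact if_neg (by intro h'; linarith [h'.1, hlp e'])
    rw [Finset.sum_congr rfl fun e _ => hPR' e, Finset.sum_congr rfl fun e _ => hPL' e,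
      Finset.sum_comm, Finset.sum_comm (f := fun e s => if l e = s then PL e e' else 0)]
    refine Finset.sum_congr rfl fun s hs => ?_
    rw [← Finset.sum_filter (fun e => r e = s), ← Finset.sum_filter (fun e => l e = s)]
    by_cases hs' : l e' < s ∧ s < r e'
    · obtain ⟨y, hy⟩ := hy s hs
      -- All edges incident to the vertex have height `y` there, so the sign depends on `e'` alone
      -- and the value is linear in `(a e, a e * m e)`.
      have hval : ∀ e, l e = s ∨ r e = s → φ e e' s =
          Real.sign (m e' * s + c e' - y) * (a e' * (m e' * a e - a e * m e)) := by
        intro e he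
        simp only [hφ, hD]
        rw [← hy e he]
        congr 1
        · congr 1; ring
        · ring
      rw [Finset.sum_congr rfl (g := fun e =>
          Real.sign (m e' * s + c e' - y) * (a e' * (m e' * a e - a e * m e))),
        Finset.sum_congr (s₁ := Finset.univ.filter fun e => l e = s) rfl (g := fun e =>
          Real.sign (m e' * s + c e' - y) * (a e' * (m e' * a e - a e * m e)))]
      · simp only [← Finset.mul_sum, Finset.sum_sub_distrib]
        rw [hbal s hs, hbal' s hs]
      · intro e he
        have he := (Finset.mem_filter.1 he).2
        rw [← hval e (Or.inl he)]
        simp only [hPL, he]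
        exact if_pos hs'
      · intro e he
        have he := (Finset.mem_filter.1 he).2
        rw [← hval e (Or.inr he)]
        simp only [hPR, he]
        exact if_pos hs'
    · rw [Finset.sum_eq_zero, Finset.sum_eq_zero]
      · intro e he
        have he := (Finset.mem_filter.1 he).2
        simp only [hPL, he]
        exact if_neg hs'
      · intro e he
        have he := (Finset.mem_filter.1 he).2
        simp only [hPR, he]
        exact if_neg hs'
  have hsame : ∑ e, ∑ e', Ls e e' ≤ ∑ e, ∑ e', Rs e e' := by
    have h := Finset.sum_le_sum fun e (_ : e ∈ Finset.univ) =>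
      Finset.sum_le_sum fun e' (_ : e' ∈ Finset.univ) => key e e'
    simp only [Finset.sum_add_distrib] at h
    rw [Finset.sum_comm (f := fun e e' => PL e' e), Finset.sum_comm (f := fun e e' => PR e' e)] at h
    linarith
  have hqS : q ∉ S := fun h => lt_irrefl _ (hq _ h)
  have hpS : p ∉ S := fun h => lt_irrefl _ (hp _ h)
  rw [Finset.sum_comm, ← sub_nonneg, ← Finset.sum_sub_distrib]
  rw [← sub_nonneg, ← Finset.sum_sub_distrib] at hsame
  refine hsame.trans_eq (Finset.sum_congr rfl fun e _ => ?_)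
  rw [Finset.sum_comm, ← Finset.sum_sub_distrib, ← Finset.sum_sub_distrib]
  refine Finset.sum_congr rfl fun e' _ => ?_
  rw [Finset.sum_add_distrib]
  have e1 : ∀ f : E → ℝ, (∑ s ∈ S, if f e = s ∧ f e' = s then |D e e'| else 0) =
      if f e ∈ S ∧ f e = f e' then |D e e'| else 0 := by
    intro f
    simp only [ite_and]
    rw [Finset.sum_ite_eq]
    simp only [eq_comm]
  change Rs e e' - Ls e e' = _ - ((∑ s ∈ S, if l e = s ∧ l e' = s then |D e e'| else 0) +
    ∑ s ∈ S, if r e = s ∧ r e' = s then |D e e'| else 0)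
  rw [e1 l, e1 r]
  have hR : Rs e e' = (if r e = q ∧ r e' = q then |D e e'| else 0) -
      if r e ∈ S ∧ r e = r e' then |D e e'| else 0 := by
    simp only [hRs]
    rcases hr e with h | h
    · simp [h, hqS, eq_comm]
    · have : r e ≠ q := fun h' => hqS (h' ▸ h)
      by_cases h' : r e = r e' <;> simp [this, h, h']
      rw [← h']; simp [this, h]
  have hL : Ls e e' = (if l e ∈ S ∧ l e = l e' then |D e e'| else 0) -
      if l e = p ∧ l e' = p then |D e e'| else 0 := by
    simp only [hLs]
    rcases hl e with h | h
    · simp only [h, hpS, true_and, false_and, if_true, if_false, @eq_comm _ p]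
      split_ifs <;> simp
    · have : l e ≠ p := fun h' => hpS (h' ▸ h)
      by_cases h' : l e = l e' <;> simp [this, h, h']
      rw [← h']; simp [this, h]
  rw [hR, hL]
  ring

/-! ### Weights -/

lemma Weight.exists_isRep {n : ℕ} (w : Weight n) : ∃ u, w.IsRep u := by
  induction w using Quotient.inductionOn with
  | _ u => exact ⟨u.1, u.2, rfl⟩

lemma Weight.IsRep.ne_zero {n : ℕ} {w : Weight n} {u : Fin n → ℤ} (h : w.IsRep u) : u ≠ 0 := h.1

lemma Weight.IsRep.eq_or_eq_neg {n : ℕ} {w : Weight n} {u v : Fin n → ℤ} (hu : w.IsRep u)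
    (hv : w.IsRep v) : u = v ∨ u = -v := by
  obtain ⟨hu0, hu⟩ := hu
  obtain ⟨hv0, hv⟩ := hv
  exact Quotient.exact (hu.trans hv.symm)

lemma Weight.IsRep.neg {n : ℕ} {w : Weight n} {u : Fin n → ℤ} (hu : w.IsRep u) :
    w.IsRep (-u) := by
  obtain ⟨hu0, hu⟩ := hu
  exact ⟨neg_ne_zero.2 hu0, (Quotient.sound (Or.inr rfl)).trans hu⟩

lemma Weight.finite_isRep {n : ℕ} (w : Weight n) : {u | w.IsRep u}.Finite := by
  obtain ⟨u, hu⟩ := w.exists_isRep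
  exact (Set.toFinite {u, -u}).subset fun v hv => by simpa using hv.eq_or_eq_neg hu

@[simp]
lemma intVec_apply {n : ℕ} (u : Fin n → ℤ) (i : Fin n) : intVec u i = u i := rfl

lemma intVec_neg {n : ℕ} (u : Fin n → ℤ) : intVec (-u) = -intVec u := by
  ext i; simp

lemma intVec_ne_zero {n : ℕ} {u : Fin n → ℤ} (hu : u ≠ 0) : intVec u ≠ 0 := by
  contrapose! hu
  ext i
  have := congrArg (fun x : EuclideanSpace ℝ (Fin n) => x i) hu
  simpa using this

lemma Weight.IsRep.norm_eq {n : ℕ} {w : Weight n} {u : Fin n → ℤ} (hu : w.IsRep u) :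
    w.norm = ‖intVec u‖ := by
  obtain ⟨hu0, rfl⟩ := hu
  rw [EuclideanSpace.norm_eq]
  simp [Weight.norm]

lemma abs_apply_le_norm_intVec {n : ℕ} (u : Fin n → ℤ) (i : Fin n) : |(u i : ℝ)| ≤ ‖intVec u‖ := by
  simpa using PiLp.norm_apply_le (intVec u) i

lemma one_le_norm_intVec {n : ℕ} {u : Fin n → ℤ} (hu : u ≠ 0) : 1 ≤ ‖intVec u‖ := by
  obtain ⟨i, hi⟩ := Function.ne_iff.1 hu
  refine le_trans ?_ (abs_apply_le_norm_intVec u i)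
  exact_mod_cast Int.one_le_abs hi

lemma Weight.norm_nonneg {n : ℕ} (w : Weight n) : 0 ≤ w.norm := by
  obtain ⟨u, hu⟩ := w.exists_isRep
  exact hu.norm_eq ▸ _root_.norm_nonneg _

/-! ### Ends of an edge with respect to a linear functional -/

/-- The point `v` of `e` minimizes the functional `X` on `e`. -/
def IsLeftEnd {n : ℕ} (X : EuclideanSpace ℝ (Fin n) →L[ℝ] ℝ) (e : Set (EuclideanSpace ℝ (Fin n)))
    (v : EuclideanSpace ℝ (Fin n)) : Prop :=
  v ∈ e ∧ ∀ x ∈ e, X v ≤ X x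

section Parallel

variable {n : ℕ} {w : Weight n} {u : Fin n → ℤ} {e : Set (EuclideanSpace ℝ (Fin n))}
  {X : EuclideanSpace ℝ (Fin n) →L[ℝ] ℝ} {v : EuclideanSpace ℝ (Fin n)}

lemma Weight.IsParallel.injOn (hw : w.IsParallel e) (hu : w.IsRep u) (hX : X (intVec u) ≠ 0) :
    Set.InjOn X e := by
  intro x hx y hy hxy
  obtain ⟨t, ht⟩ := hw u hu x hx y hy
  have h := congrArg X ht
  rw [map_sub, map_smul, hxy, sub_self, smul_eq_mul, eq_comm, mul_eq_zero] at h
  rw [h.resolve_right hX, zero_smul, sub_eq_zero] at ht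
  exact ht.symm

/-- The minimizers of a linear functional form a face, which injectivity of `X` on `e` reduces to
one point. -/
lemma IsLeftEnd.mem_extremePoints (h : IsLeftEnd X e v) (hX : Set.InjOn X e) :
    v ∈ e.extremePoints ℝ := by
  refine _root_.mem_extremePoints.2 ⟨h.1, ?_⟩
  rintro x hx y hy ⟨α, β, hα, hβ, hαβ, rfl⟩
  have hx' := h.2 x hx
  have hy' := h.2 y hy
  set z := α • x + β • y with hz
  have hz' : X z = α * X x + β * X y := by simp [hz]
  have h0 : α * (X x - X z) + β * (X y - X z) = 0 := by linear_combination -hz' - X z * hαβ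
  have hα' := mul_nonneg hα.le (sub_nonneg.2 hx')
  have hβ' := mul_nonneg hβ.le (sub_nonneg.2 hy')
  have h1 : X x = X z :=
    sub_eq_zero.1 ((mul_eq_zero.1 (by linarith : α * (X x - X z) = 0)).resolve_left hα.ne')
  have h2 : X y = X z :=
    sub_eq_zero.1 ((mul_eq_zero.1 (by linarith : β * (X y - X z) = 0)).resolve_left hβ.ne')
  exact ⟨hX hx h.1 h1, hX hy h.1 h2⟩

/-- A point that is neither extremum of `X` has points of the edge on both sides, and collinearity
puts it strictly between them. -/
lemma isLeftEnd_or_isLeftEnd_neg (hw : w.IsParallel e) (hu : w.IsRep u) (hX : X (intVec u) ≠ 0)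
    (hv : v ∈ e.extremePoints ℝ) : IsLeftEnd X e v ∨ IsLeftEnd (-X) e v := by
  rw [mem_extremePoints] at hv
  obtain ⟨hve, hv⟩ := hv
  by_contra! hcon
  obtain ⟨h1, h2⟩ := hcon
  simp only [IsLeftEnd, hve, true_and, not_forall, not_le, neg_apply,
    neg_lt_neg_iff] at h1 h2
  obtain ⟨x, hx, hxv⟩ := h1
  obtain ⟨y, hy, hyv⟩ := h2
  obtain ⟨s, hs⟩ := hw u hu x hx v hve
  obtain ⟨t, ht⟩ := hw u hu x hx y hy
  have hs' : X v - X x = s * X (intVec u) := by rw [← map_sub, hs]; simp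
  have ht' : X y - X x = t * X (intVec u) := by rw [← map_sub, ht]; simp
  have hpos : 0 < X y - X x := by linarith
  have hmem : v ∈ openSegment ℝ x y := by
    rw [openSegment_eq_image']
    refine ⟨(X v - X x) / (X y - X x), ⟨div_pos (by linarith) hpos,
      (div_lt_one hpos).2 (by linarith)⟩, ?_⟩
    have ht0 : t ≠ 0 := by rintro rfl; rw [zero_mul] at ht'; linarith
    simp only
    rw [hs', ht', ht, mul_div_mul_right _ _ hX, smul_smul, div_mul_cancel₀ _ ht0, ← hs]
    abel
  have := (hv x hx y hy hmem).1
  rw [this] at hxv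
  exact lt_irrefl _ hxv

lemma IsLeftEnd.pos_of_pointsOutward (h : IsLeftEnd X e v) (hX : X (intVec u) ≠ 0)
    (hu : PointsOutward v e u) : 0 < X (intVec u) := by
  obtain ⟨x, hx, t, ht, hxt⟩ := hu
  have h1 := h.2 x hx
  have h2 : X x - X v = t * X (intVec u) := by rw [← map_sub, hxt]; simp
  refine lt_of_le_of_ne ?_ hX.symm
  by_contra! h3
  nlinarith

lemma IsLeftEnd.eq_of_pointsOutward {u' : Fin n → ℤ} (h : IsLeftEnd X e v) (hu : w.IsRep u)
    (hX : 0 < X (intVec u)) (hu' : w.IsRep u') (hp : PointsOutward v e u') : u' = u := by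
  rcases hu'.eq_or_eq_neg hu with rfl | rfl
  · rfl
  · have := h.pos_of_pointsOutward (by rw [intVec_neg, map_neg]; linarith) hp
    rw [intVec_neg, map_neg] at this
    linarith

end Parallel

/-! ### Edges in a ball and at a vertex -/

namespace TropicalCurve

variable {n : ℕ} {U : Set (EuclideanSpace ℝ (Fin n))} (G : TropicalCurve U)

lemma mem_vertices_of_isLeftEnd {X : EuclideanSpace ℝ (Fin n) →L[ℝ] ℝ} (e : G.edges)
    {u : Fin n → ℤ} (hu : (G.weight e).IsRep u) (hX : X (intVec u) ≠ 0)
    {v : EuclideanSpace ℝ (Fin n)} (h : IsLeftEnd X e.1 v) : v ∈ G.vertices := by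
  have := h.mem_extremePoints ((G.weight_parallel e).injOn hu hX)
  rw [← G.edge_endpoints e.1 e.2] at this
  exact this.2

lemma isLeftEnd_or_isLeftEnd_neg {X : EuclideanSpace ℝ (Fin n) →L[ℝ] ℝ} (e : G.edges)
    {u : Fin n → ℤ} (hu : (G.weight e).IsRep u) (hX : X (intVec u) ≠ 0)
    {v : EuclideanSpace ℝ (Fin n)} (hv : v ∈ G.vertices) (hve : v ∈ e.1) :
    IsLeftEnd X e.1 v ∨ IsLeftEnd (-X) e.1 v := by
  refine _root_.isLeftEnd_or_isLeftEnd_neg (G.weight_parallel e) hu hX ?_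
  rw [← G.edge_endpoints e.1 e.2]
  exact ⟨hve, hv⟩

/-- An edge contained in a ball that lies in `U` has an end in that ball. -/
lemma exists_isLeftEnd {X : EuclideanSpace ℝ (Fin n) →L[ℝ] ℝ} (e : G.edges)
    {c : EuclideanSpace ℝ (Fin n)} {r : ℝ} (hU : Metric.closedBall c r ⊆ U)
    (he : e.1 ⊆ Metric.ball c r) : ∃ v, IsLeftEnd X e.1 v := by
  have hcl : closure e.1 ⊆ Metric.closedBall c r :=
    closure_minimal (he.trans Metric.ball_subset_closedBall) Metric.isClosed_closedBall
  have hclosed : IsClosed e.1 := by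
    refine closure_subset_iff_isClosed.1 fun x hx => G.edge_closed e.1 e.2 ⟨hx, hU (hcl hx)⟩
  have hcomp : IsCompact e.1 := (isCompact_closedBall c r).of_isClosed_subset hclosed
    (subset_closure.trans hcl)
  obtain ⟨v, hv, hmin⟩ := hcomp.exists_isMinOn (G.edge_nontrivial e.1 e.2).nonempty
    X.continuous.continuousOn
  exact ⟨v, hv, fun x hx => hmin hx⟩

/-- An edge that meets an open ball and is not contained in it meets the sphere. -/
lemma inter_sphere_nonempty (e : G.edges) {c v : EuclideanSpace ℝ (Fin n)} {r : ℝ}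
    (hv : v ∈ e.1) (hvr : v ∈ Metric.ball c r) (he : ¬ e.1 ⊆ Metric.ball c r) :
    (e.1 ∩ Metric.sphere c r).Nonempty := by
  obtain ⟨x, hx, hxr⟩ := Set.not_subset.1 he
  rw [Metric.mem_ball, not_lt] at hxr
  obtain ⟨y, hy, hyr⟩ := (G.edge_convex e.1 e.2).isPreconnected.intermediate_value hv hx
    (f := fun z => dist z c) (by fun_prop) ⟨(Metric.mem_ball.1 hvr).le, hxr⟩
  exact ⟨y, hy, hyr⟩

/-- Distinct edges leave a vertex in distinct directions. -/
lemma eq_of_same_direction {e e' : G.edges} {v : EuclideanSpace ℝ (Fin n)}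
    (hve : v ∈ e.1) (hve' : v ∈ e'.1) {ρ ρ' : Fin n → ℤ} (hρ0 : ρ ≠ 0)
    (hρ : PointsOutward v e.1 ρ) (hρ' : PointsOutward v e'.1 ρ') {α β : ℝ} (hα : 0 < α)
    (hβ : 0 < β) (h : α • intVec ρ = β • intVec ρ') : e = e' := by
  by_contra hne
  obtain ⟨x, hx, s, hs, hxs⟩ := hρ
  obtain ⟨x', hx', s', hs', hxs'⟩ := hρ'
  have hray : x' - v = (s' * (α / β)) • intVec ρ := by
    rw [hxs', mul_smul, div_eq_inv_mul, mul_smul, h, smul_smul β⁻¹, inv_mul_cancel₀ hβ.ne',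
      one_smul]
  have hs'' : 0 < s' * (α / β) := by positivity
  set τ := min s (s' * (α / β)) with hτ
  have hτ0 : 0 < τ := lt_min hs hs''
  have hmem : ∀ f : G.edges, v ∈ f.1 → ∀ y ∈ f.1, ∀ t : ℝ, 0 < t → y - v = t • intVec ρ →
      ∀ a, 0 ≤ a → a ≤ t → v + a • intVec ρ ∈ f.1 := by
    intro f hvf y hy t ht hyt a ha hat
    have : v + a • intVec ρ = v + (a / t) • (y - v) := by
      rw [hyt, smul_smul, div_mul_cancel₀ _ ht.ne']
    rw [this]
    exact (G.edge_convex f.1 f.2).add_smul_sub_mem hvf hy ⟨by positivity, (div_le_one ht).2 hat⟩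
  have hz := hmem e hve x hx s hs hxs
  have hz' := hmem e' hve' x' hx' _ hs'' hray
  -- The edges share an initial segment of parameter length `τ`. Its midpoint would be a vertex,
  -- hence an extreme point of `e`, which is absurd.
  have hmid : v + (τ / 2) • intVec ρ ∈ e.1 ∩ (G.vertices : Set _) := by
    have h1 := hz (τ / 2) (by positivity) (by linarith [min_le_left s (s' * (α / β))])
    have h2 := hz' (τ / 2) (by positivity) (by linarith [min_le_right s (s' * (α / β))])
    exact ⟨h1, G.edge_inter e.1 e.2 e'.1 e'.2 (fun h => hne (Subtype.ext h)) ⟨h1, h2⟩⟩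
  rw [G.edge_endpoints e.1 e.2, mem_extremePoints] at hmid
  have := (hmid.2 v hve (v + τ • intVec ρ) (hz τ hτ0.le (min_le_left _ _)) (by
    rw [openSegment_eq_image']
    refine ⟨1 / 2, by norm_num, ?_⟩
    simp only [add_sub_cancel_left, smul_smul]
    congr 2; ring)).1
  rw [left_eq_add, smul_eq_zero] at this
  rcases this with h | h
  · linarith
  · exact intVec_ne_zero hρ0 h

end TropicalCurve

/-! ### Choice of the sphere, and balancing relative to a functional -/

namespace TropicalCurve

variable {n : ℕ} {U : Set (EuclideanSpace ℝ (Fin n))} (G : TropicalCurve U)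

open MeasureTheory in
open scoped Classical in
/-- In a ball of radius `R`, the total weight of the edges that meet a well-chosen concentric
sphere is bounded in terms of the area. -/
lemma exists_radius_sum_norm_le (c : EuclideanSpace ℝ (Fin n)) {R A : ℝ} (hR : 0 < R) (hA : 0 < A)
    (hG : G.area ≤ ENNReal.ofReal A) :
    ∃ r ∈ Set.Ioo (R / 2) R,
      ∑ e : G.edges, (if (e.1 ∩ Metric.sphere c r).Nonempty then (G.weight e).norm else 0) ≤
        4 * A / R := by
  by_contra! hcon
  -- The radii of the spheres that meet `e`. Distance to `c` is 1-Lipschitz, so this set has measure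
  -- at most the length of `e`.
  set I : G.edges → Set ℝ := fun e => (fun x => dist x c) '' e.1 with hI
  have hmeas : ∀ e, MeasurableSet (I e) := fun e =>
    ((G.edge_convex e.1 e.2).isPreconnected.image _
      (by fun_prop)).ordConnected.measurableSet
  have hvol : ∀ e, volume (I e) ≤ Metric.ediam e.1 := fun e =>
    (Real.volume_le_diam _).trans <| by
      simpa using (LipschitzWith.dist_left c).ediam_image_le e.1
  set f : ℝ → ENNReal := fun r =>
    ∑ e, (I e).indicator (fun _ => ENNReal.ofReal (G.weight e).norm) r with hf
  have hub : ∫⁻ r in Set.Ioo (R / 2) R, f r ≤ ENNReal.ofReal A := by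
    refine (setLIntegral_le_lintegral _ _).trans ?_
    rw [hf, lintegral_finsetSum _ fun e _ => measurable_const.indicator (hmeas e)]
    refine le_trans (Finset.sum_le_sum fun e _ => ?_) hG
    rw [lintegral_indicator_const (hmeas e), mul_comm]
    gcongr
    exact hvol e
  -- The interval of radii has length `R / 2`; the constant `4 * A / R` leaves a factor 2 over the
  -- area, so weak inequalities suffice for the contradiction.
  have hlb : ENNReal.ofReal (2 * A) ≤ ∫⁻ r in Set.Ioo (R / 2) R, f r := by
    calc ENNReal.ofReal (2 * A)
        = ∫⁻ _ in Set.Ioo (R / 2) R, ENNReal.ofReal (4 * A / R) := by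
          rw [setLIntegral_const, Real.volume_Ioo, ← ENNReal.ofReal_mul (by positivity)]
          congr 1
          field_simp
          ring
      _ ≤ ∫⁻ r in Set.Ioo (R / 2) R, f r := by
          refine setLIntegral_mono' measurableSet_Ioo fun r hr => ?_
          refine (ENNReal.ofReal_le_ofReal (hcon r hr).le).trans_eq ?_
          rw [ENNReal.ofReal_sum_of_nonneg]
          · refine Finset.sum_congr rfl fun e _ => ?_
            have : r ∈ I e ↔ (e.1 ∩ Metric.sphere c r).Nonempty := Iff.rfl
            simp only [Set.indicator_apply, this]
            split_ifs <;> simp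
          · intro e _
            split_ifs
            · exact (G.weight e).norm_nonneg
            · exact le_rfl
  have := (ENNReal.ofReal_le_ofReal_iff hA.le).1 (hlb.trans hub)
  linarith

open scoped Classical in
/-- The balancing condition, with the edges oriented by a functional `X`. -/
lemma sum_right_eq_sum_left {X : EuclideanSpace ℝ (Fin n) →L[ℝ] ℝ} {u : G.edges → Fin n → ℤ}
    (hu : ∀ e, (G.weight e).IsRep (u e)) (hX : ∀ e, 0 < X (intVec (u e)))
    {v : EuclideanSpace ℝ (Fin n)} (hv : v ∈ G.vertices) (φ : EuclideanSpace ℝ (Fin n) →L[ℝ] ℝ) :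
    ∑ e : G.edges with IsLeftEnd (-X) e.1 v, φ (intVec (u e)) =
      ∑ e : G.edges with IsLeftEnd X e.1 v, φ (intVec (u e)) := by
  obtain ⟨ρ, hρ, hsum⟩ := G.balancing v hv
  have hzero : ∑ e : G.edges with v ∈ e.1, φ (intVec (ρ e)) = 0 := by
    rw [← map_sum]
    have : ∑ e : G.edges with v ∈ e.1, intVec (ρ e) = 0 := by
      ext i
      have h := congrFun hsum i
      rw [Finset.sum_apply, Pi.zero_apply] at h
      simp only [WithLp.ofLp_sum, Finset.sum_apply, intVec_apply, PiLp.zero_apply]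
      exact_mod_cast h
    rw [this, map_zero]
  rw [eq_comm, ← sub_eq_zero, ← hzero, Finset.sum_filter, Finset.sum_filter, Finset.sum_filter,
    ← Finset.sum_sub_distrib]
  refine Finset.sum_congr rfl fun e _ => ?_
  by_cases hve : v ∈ e.1
  · obtain ⟨hr, hp⟩ := hρ e hve
    -- The orientation by `X` is outward at left ends and inward at right ends.
    have hleft : IsLeftEnd X e.1 v → ρ e = u e := fun h =>
      h.eq_of_pointsOutward (hu e) (hX e) hr hp
    have hright : IsLeftEnd (-X) e.1 v → ρ e = -u e := fun h =>
      h.eq_of_pointsOutward (hu e).neg (by simpa [intVec_neg] using hX e) hr hp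
    have hne : u e ≠ -u e := fun h => (hu e).ne_zero (self_eq_neg.1 h)
    rcases G.isLeftEnd_or_isLeftEnd_neg e (hu e) (hX e).ne' hv hve with h | h
    · have h' : ¬ IsLeftEnd (-X) e.1 v := fun h' => hne ((hleft h).symm.trans (hright h'))
      simp [h, h', hve, hleft h]
    · have h' : ¬ IsLeftEnd X e.1 v := fun h' => hne ((hleft h').symm.trans (hright h))
      simp [h, h', hve, hright h, intVec_neg]
  · have h1 : ¬ IsLeftEnd X e.1 v := fun h => hve h.1
    have h2 : ¬ IsLeftEnd (-X) e.1 v := fun h => hve h.1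
    simp [h1, h2, hve]

end TropicalCurve

/-! ### Projection of a curve in a ball to the plane -/

open scoped Classical in
/-- The value of `X` at the left end of `e`, if that end is in `V`, and `p` otherwise. -/
noncomputable def leftPos {n : ℕ} (V : Finset (EuclideanSpace ℝ (Fin n)))
    (X : EuclideanSpace ℝ (Fin n) →L[ℝ] ℝ) (p : ℝ) (e : Set (EuclideanSpace ℝ (Fin n))) : ℝ :=
  if h : ∃ v ∈ V, IsLeftEnd X e v then X h.choose else p

section LeftPos

variable {n : ℕ} {V : Finset (EuclideanSpace ℝ (Fin n))}
    {X : EuclideanSpace ℝ (Fin n) →L[ℝ] ℝ} {p : ℝ} {e : Set (EuclideanSpace ℝ (Fin n))}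
    {v : EuclideanSpace ℝ (Fin n)}

lemma leftPos_of_not_exists (h : ¬ ∃ v ∈ V, IsLeftEnd X e v) : leftPos V X p e = p := dif_neg h

lemma leftPos_eq (hv : v ∈ V) (h : IsLeftEnd X e v) : leftPos V X p e = X v := by
  have hex : ∃ v ∈ V, IsLeftEnd X e v := ⟨v, hv, h⟩
  rw [leftPos, dif_pos hex]
  exact le_antisymm (hex.choose_spec.2.2 _ h.1) (h.2 _ hex.choose_spec.2.1)

lemma leftPos_eq_iff (hp : ∀ v ∈ V, p < X v) (hinj : Set.InjOn X V) (hv : v ∈ V) :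
    leftPos V X p e = X v ↔ IsLeftEnd X e v := by
  refine ⟨fun h => ?_, leftPos_eq hv⟩
  by_cases hex : ∃ v ∈ V, IsLeftEnd X e v
  · obtain ⟨w, hw, hwe⟩ := hex
    rw [leftPos_eq hw hwe] at h
    exact hinj hw hv h ▸ hwe
  · rw [leftPos_of_not_exists hex] at h
    exact absurd h (hp v hv).ne

lemma leftPos_eq_self_iff (hp : ∀ v ∈ V, p < X v) :
    leftPos V X p e = p ↔ ¬ ∃ v ∈ V, IsLeftEnd X e v := by
  refine ⟨?_, leftPos_of_not_exists⟩
  rintro h ⟨w, hw, hwe⟩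
  rw [leftPos_eq hw hwe] at h
  exact (hp w hw).ne' h

end LeftPos

namespace TropicalCurve

variable {n : ℕ} {U : Set (EuclideanSpace ℝ (Fin n))} (G : TropicalCurve U)

open scoped Classical in
/-- A Bézout-type inequality for the part of a tropical curve in a ball, projected to the plane
by a generic functional `X` and a coordinate. -/
theorem sum_det_vertices_le {X : EuclideanSpace ℝ (Fin n) →L[ℝ] ℝ} (j : Fin n)
    {c : EuclideanSpace ℝ (Fin n)} {ε : ℝ} (hU : Metric.closedBall c ε ⊆ U)
    {u : G.edges → Fin n → ℤ} (hu : ∀ e, (G.weight e).IsRep (u e))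
    (hX : ∀ e, 0 < X (intVec (u e))) (hinj : Set.InjOn X G.vertices) :
    ∑ v ∈ G.vertices with v ∈ Metric.ball c ε, ∑ e : G.edges, ∑ e' : G.edges,
      ((if IsLeftEnd X e.1 v ∧ IsLeftEnd X e'.1 v then
        |X (intVec (u e)) * u e' j - X (intVec (u e')) * u e j| else 0) +
      (if IsLeftEnd (-X) e.1 v ∧ IsLeftEnd (-X) e'.1 v then
        |X (intVec (u e)) * u e' j - X (intVec (u e')) * u e j| else 0)) ≤
    ∑ e : G.edges, ∑ e' : G.edges,
      if (e.1 ∩ Metric.sphere c ε).Nonempty ∧ (e'.1 ∩ Metric.sphere c ε).Nonempty then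
        2 * |X (intVec (u e)) * u e' j - X (intVec (u e')) * u e j| else 0 := by
  set V := G.vertices.filter (· ∈ Metric.ball c ε) with hV
  have hVG : ∀ v ∈ V, v ∈ G.vertices := fun v hv => (Finset.mem_filter.1 hv).1
  have hVb : ∀ v ∈ V, v ∈ Metric.ball c ε := fun v hv => (Finset.mem_filter.1 hv).2
  have hinjV : Set.InjOn X V := hinj.mono fun v hv => hVG v hv
  have hinjV' : Set.InjOn (-X) V := fun v hv w hw h => hinjV hv hw (neg_injective h)
  set q : ℝ := 1 + ∑ v ∈ V, |X v| with hq
  have hq0 : 0 < q := by positivity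
  have hXq : ∀ v ∈ V, |X v| < q := fun v hv => by
    have := Finset.single_le_sum (f := fun v => |X v|) (fun _ _ => abs_nonneg _) hv
    linarith
  have hqX : ∀ v ∈ V, -q < X v := fun v hv => (abs_lt.1 (hXq v hv)).1
  have hXq' : ∀ v ∈ V, X v < q := fun v hv => (abs_lt.1 (hXq v hv)).2
  have hqX' : ∀ v ∈ V, -q < (-X) v := fun v hv => neg_lt_neg (hXq' v hv)
  -- An edge without a left or right end in the ball is prolonged in a straight line to `-q` or `q`,
  -- beyond all projected vertices. Any crossings this creates are harmless.
  set l : G.edges → ℝ := fun e => leftPos V X (-q) e.1 with hl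
  set r : G.edges → ℝ := fun e => -leftPos V (-X) (-q) e.1 with hr
  have hlv : ∀ e, ∀ v ∈ V, l e = X v ↔ IsLeftEnd X e.1 v := fun e v hv =>
    leftPos_eq_iff hqX hinjV hv
  have hrv : ∀ e, ∀ v ∈ V, r e = X v ↔ IsLeftEnd (-X) e.1 v := fun e v hv => by
    rw [← leftPos_eq_iff hqX' hinjV' hv, neg_eq_iff_eq_neg]; rfl
  have hlp : ∀ e, l e = -q ↔ ¬ ∃ v ∈ V, IsLeftEnd X e.1 v := fun e => leftPos_eq_self_iff hqX
  have hrq : ∀ e, r e = q ↔ ¬ ∃ v ∈ V, IsLeftEnd (-X) e.1 v := fun e => by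
    rw [← leftPos_eq_self_iff hqX', neg_eq_iff_eq_neg]
  -- Edges with no vertex in the ball are discarded by giving them weight zero. With `m` below, `a e
  -- • (1, m e)` is otherwise the projected weight `(X (intVec (u e)), u e j)`.
  set a : G.edges → ℝ := fun e => if ∃ v ∈ V, v ∈ e.1 then X (intVec (u e)) else 0 with ha
  set m : G.edges → ℝ := fun e => u e j / X (intVec (u e)) with hm
  set z : G.edges → EuclideanSpace ℝ (Fin n) := fun e =>
    (G.edge_nontrivial e.1 e.2).nonempty.some with hz
  have hze : ∀ e, z e ∈ e.1 := fun e => (G.edge_nontrivial e.1 e.2).nonempty.some_mem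
  have hline : ∀ e, ∀ x ∈ e.1, m e * X x + (z e j - m e * X (z e)) = x j := by
    intro e x hx
    obtain ⟨t, ht⟩ := G.weight_parallel e (u e) (hu e) (z e) (hze e) x hx
    have h1 : X x - X (z e) = t * X (intVec (u e)) := by rw [← map_sub, ht]; simp
    have h2 : x j - z e j = t * u e j := by
      simpa using congrArg (fun y : EuclideanSpace ℝ (Fin n) => y j) ht
    have h3 : m e * X (intVec (u e)) = u e j := div_mul_cancel₀ _ (hX e).ne'
    linear_combination m e * h1 - h2 + t * h3
  have hterm : ∀ e e', a e * a e' * (m e' - m e) =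
      if (∃ v ∈ V, v ∈ e.1) ∧ ∃ v ∈ V, v ∈ e'.1 then
        X (intVec (u e)) * u e' j - X (intVec (u e')) * u e j else 0 := by
    intro e e'
    have h1 := (hX e).ne'
    have h2 := (hX e').ne'
    by_cases h : ∃ v ∈ V, v ∈ e.1 <;> by_cases h' : ∃ v ∈ V, v ∈ e'.1 <;>
      simp only [ha, hm, h, h', if_true, if_false, and_true, and_false, zero_mul, mul_zero]
    field_simp
  have hedge : ∀ e, l e < r e := by
    intro e
    by_cases h1 : ∃ v ∈ V, IsLeftEnd X e.1 v <;> by_cases h2 : ∃ v ∈ V, IsLeftEnd (-X) e.1 v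
    · obtain ⟨v, hv, hve⟩ := h1
      obtain ⟨w, hw, hwe⟩ := h2
      rw [(hlv e v hv).2 hve, (hrv e w hw).2 hwe]
      by_contra! hwv
      refine (G.edge_nontrivial e.1 e.2).not_subsingleton fun x hx y hy =>
        (G.weight_parallel e).injOn (hu e) (hX e).ne' hx hy ?_
      have hx1 := hve.2 x hx
      have hy1 := hve.2 y hy
      have hx2 : X x ≤ X w := neg_le_neg_iff.1 (hwe.2 x hx)
      have hy2 : X y ≤ X w := neg_le_neg_iff.1 (hwe.2 y hy)
      linarith
    · obtain ⟨v, hv, hve⟩ := h1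
      rw [(hlv e v hv).2 hve, (hrq e).2 h2]
      exact hXq' v hv
    · obtain ⟨w, hw, hwe⟩ := h2
      rw [(hrv e w hw).2 hwe, (hlp e).2 h1]
      exact hqX w hw
    · rw [(hrq e).2 h2, (hlp e).2 h1]
      linarith
  have hbal : ∀ v ∈ V, ∀ (φ : EuclideanSpace ℝ (Fin n) →L[ℝ] ℝ) (g : G.edges → ℝ),
      (∀ e, v ∈ e.1 → g e = φ (intVec (u e))) →
      ∑ e with r e = X v, g e = ∑ e with l e = X v, g e := by
    intro v hv φ g hg
    simp only [hlv _ v hv, hrv _ v hv]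
    have h := G.sum_right_eq_sum_left hu hX (hVG v hv) φ
    rw [Finset.sum_congr rfl fun e he => hg e (Finset.mem_filter.1 he).2.1,
      Finset.sum_congr rfl fun e he => hg e (Finset.mem_filter.1 he).2.1, h]
  have haX : ∀ v ∈ V, ∀ e : G.edges, v ∈ e.1 → a e = X (intVec (u e)) := fun v hv e hve =>
    if_pos ⟨v, hv, hve⟩
  have key := planar_balanced_graph_inequality a m (fun e => z e j - m e * X (z e)) l r
    (V.image X) (-q) q
    (fun e => by
      simp only [ha]
      split_ifs
      · exact (hX e).le
      · exact le_rfl)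
    hedge
    (fun e => by
      by_cases h : ∃ v ∈ V, IsLeftEnd X e.1 v
      · obtain ⟨v, hv, hve⟩ := h
        exact Or.inr (Finset.mem_image.2 ⟨v, hv, ((hlv e v hv).2 hve).symm⟩)
      · exact Or.inl ((hlp e).2 h))
    (fun e => by
      by_cases h : ∃ v ∈ V, IsLeftEnd (-X) e.1 v
      · obtain ⟨v, hv, hve⟩ := h
        exact Or.inr (Finset.mem_image.2 ⟨v, hv, ((hrv e v hv).2 hve).symm⟩)
      · exact Or.inl ((hrq e).2 h))
    (Finset.forall_mem_image.2 hqX) (Finset.forall_mem_image.2 hXq')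
    (Finset.forall_mem_image.2 fun v hv => ⟨v j, fun e he => by
      rw [hlv e v hv, hrv e v hv] at he
      exact hline e v (he.elim (fun h => h.1) fun h => h.1)⟩)
    (Finset.forall_mem_image.2 fun v hv => hbal v hv X a (haX v hv))
    (Finset.forall_mem_image.2 fun v hv => hbal v hv (EuclideanSpace.proj j)
      (fun e => a e * m e) fun e hve => by
        rw [haX v hv e hve]
        exact mul_div_cancel₀ _ (hX e).ne')
  rw [Finset.sum_image hinjV] at key
  simp only [hterm] at key
  refine le_trans (le_of_eq ?_) (key.trans ?_)
  · refine Finset.sum_congr rfl fun v hv => Finset.sum_congr rfl fun e _ =>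
      Finset.sum_congr rfl fun e' _ => ?_
    simp only [hlv e v hv, hlv e' v hv, hrv e v hv, hrv e' v hv]
    congr 1
    · by_cases h : IsLeftEnd X e.1 v ∧ IsLeftEnd X e'.1 v
      · rw [if_pos h, if_pos h, if_pos ⟨⟨v, hv, h.1.1⟩, ⟨v, hv, h.2.1⟩⟩]
      · rw [if_neg h, if_neg h]
    · by_cases h : IsLeftEnd (-X) e.1 v ∧ IsLeftEnd (-X) e'.1 v
      · rw [if_pos h, if_pos h, if_pos ⟨⟨v, hv, h.1.1⟩, ⟨v, hv, h.2.1⟩⟩]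
      · rw [if_neg h, if_neg h]
  · refine Finset.sum_le_sum fun e _ => Finset.sum_le_sum fun e' _ => ?_
    -- An edge with a vertex in the ball that lacks an end there must leave the ball, so a prolonged
    -- edge of nonzero weight is paid for by the sphere.
    have hhit : ∀ e : G.edges, (∃ v ∈ V, v ∈ e.1) → ∀ Y : EuclideanSpace ℝ (Fin n) →L[ℝ] ℝ,
        Y (intVec (u e)) ≠ 0 → (¬ ∃ v ∈ V, IsLeftEnd Y e.1 v) →
        (e.1 ∩ Metric.sphere c ε).Nonempty := by
      rintro e ⟨v, hv, hve⟩ Y hY hno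
      refine G.inter_sphere_nonempty e hve (hVb v hv) fun hsub => hno ?_
      obtain ⟨w, hw⟩ := G.exists_isLeftEnd (X := Y) e hU hsub
      exact ⟨w, Finset.mem_filter.2 ⟨G.mem_vertices_of_isLeftEnd e (hu e) hY hw, hsub hw.1⟩, hw⟩
    set d := X (intVec (u e)) * u e' j - X (intVec (u e')) * u e j with hd
    by_cases ht : (∃ v ∈ V, v ∈ e.1) ∧ ∃ v ∈ V, v ∈ e'.1
    · rw [if_pos ht]
      have hd0 := abs_nonneg d
      by_cases hh : (e.1 ∩ Metric.sphere c ε).Nonempty ∧ (e'.1 ∩ Metric.sphere c ε).Nonempty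
      · rw [if_pos hh]
        split_ifs <;> linarith
      · rw [if_neg hh, if_neg, if_neg, add_zero]
        · rw [hrq, hrq]
          rintro ⟨h1, h2⟩
          exact hh ⟨hhit e ht.1 (-X) (neg_ne_zero.2 (hX e).ne') h1,
            hhit e' ht.2 (-X) (neg_ne_zero.2 (hX e').ne') h2⟩
        · rw [hlp, hlp]
          rintro ⟨h1, h2⟩
          exact hh ⟨hhit e ht.1 X (hX e).ne' h1, hhit e' ht.2 X (hX e').ne' h2⟩
    · rw [if_neg ht]
      simp only [abs_zero, ite_self, add_zero]
      positivity

end TropicalCurve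

/-! ### Generic functionals -/

open scoped Topology

/-- A functional can be perturbed so that it does not vanish on finitely many given vectors. -/
lemma exists_generic_functional {F : Type*} [NormedAddCommGroup F] [NormedSpace ℝ F]
    (D : Set F) (hD : D.Finite) (hD0 : ∀ d ∈ D, d ≠ 0) (Y : F →L[ℝ] ℝ) {s : Set (F →L[ℝ] ℝ)}
    (hs : s ∈ 𝓝 Y) : ∃ X ∈ s, ∀ d ∈ D, X d ≠ 0 := by
  have hdense : Dense (⋂ d ∈ D, {X : F →L[ℝ] ℝ | X d ≠ 0}) := by
    refine dense_biInter_of_isOpen (fun d _ => ?_) hD.countable fun d hd => ?_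
    · exact isOpen_ne_fun (by fun_prop) continuous_const
    · let ev : (F →L[ℝ] ℝ) →ₗ[ℝ] ℝ :=
        { toFun := fun X => X d, map_add' := fun _ _ => rfl, map_smul' := fun _ _ => rfl }
      have hker : {X : F →L[ℝ] ℝ | X d ≠ 0} = ((LinearMap.ker ev : Set (F →L[ℝ] ℝ)))ᶜ := by
        ext X; simp [ev]
      rw [hker, ← interior_eq_empty_iff_dense_compl, ← Set.not_nonempty_iff_eq_empty]
      intro hne
      -- A subspace with interior is everything, but a norming functional of `d` does not vanish at
      -- `d`.
      have htop := Submodule.eq_top_of_nonempty_interior' _ hne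
      obtain ⟨g, -, hg⟩ := exists_dual_vector ℝ d (norm_ne_zero_iff.2 (hD0 d hd))
      have : g ∈ LinearMap.ker ev := htop ▸ Submodule.mem_top
      have h0 : g d = 0 := this
      rw [hg] at h0
      exact hD0 d hd (norm_eq_zero.1 (by exact_mod_cast h0))
  obtain ⟨X, hX, hXs⟩ := hdense.inter_nhds_nonempty hs
  exact ⟨X, hXs, fun d hd => Set.mem_iInter₂.1 hX d hd⟩

/-! ### Counting vertices in a ball -/

namespace TropicalCurve

variable {n : ℕ} {U : Set (EuclideanSpace ℝ (Fin n))} (G : TropicalCurve U)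

/-- If all these minors vanished, the two directions would be proportional, with a positive factor
because `X` is positive on both; but distinct edges leave `v` in distinct directions. -/
lemma exists_minor_ne_zero {X : EuclideanSpace ℝ (Fin n) →L[ℝ] ℝ} {i : Fin n} {e e' : G.edges}
    (hne : e ≠ e') {v : EuclideanSpace ℝ (Fin n)} (hve : v ∈ e.1) (hve' : v ∈ e'.1)
    {ρ ρ' : Fin n → ℤ} (hρ : PointsOutward v e.1 ρ) (hρ' : PointsOutward v e'.1 ρ')
    (hi : ρ i ≠ 0) (hX : 0 < X (intVec ρ)) (hX' : 0 < X (intVec ρ')) :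
    ∃ j, ρ i * ρ' j - ρ' i * ρ j ≠ 0 := by
  by_contra! hcon
  have h : (ρ i : ℝ) • intVec ρ' = (ρ' i : ℝ) • intVec ρ := by
    ext j
    have := sub_eq_zero.1 (hcon j)
    simp only [PiLp.smul_apply, intVec_apply, smul_eq_mul]
    exact_mod_cast this
  have hi' : (ρ i : ℝ) ≠ 0 := by exact_mod_cast hi
  have h1 := congrArg X h
  simp only [map_smul, smul_eq_mul] at h1
  have hρ0 : ρ ≠ 0 := by rintro rfl; exact hi rfl
  refine hne (G.eq_of_same_direction hve hve' hρ0 hρ hρ' hX' hX ?_)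
  refine smul_right_injective _ hi' ?_
  simp only
  rw [smul_smul, h1, smul_comm (ρ i : ℝ), h, smul_smul, mul_comm]

/-- At each vertex there is a coordinate such that, for all functionals close to it, two edges on
the same side have linearly independent projections. -/
lemma exists_independent_edges {v : EuclideanSpace ℝ (Fin n)} (hv : v ∈ G.vertices) :
    ∃ i, ∀ (X : EuclideanSpace ℝ (Fin n) →L[ℝ] ℝ) (u : G.edges → Fin n → ℤ),
      (∀ e, (G.weight e).IsRep (u e)) → (∀ e, 0 < X (intVec (u e))) →
      (∀ e, |X (intVec (u e)) - u e i| < 1 / 2) →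
      ∃ j e e', ((IsLeftEnd X e.1 v ∧ IsLeftEnd X e'.1 v) ∨
        (IsLeftEnd (-X) e.1 v ∧ IsLeftEnd (-X) e'.1 v)) ∧
        u e i * u e' j - u e' i * u e j ≠ 0 := by
  classical
  obtain ⟨ρ, hρ, hsum⟩ := G.balancing v hv
  have hval := G.valence v hv
  have hne : ∃ e : G.edges, v ∈ e.1 := by
    obtain ⟨f, hf⟩ := Finset.card_pos.1 (by omega : 0 < (G.edges.filter fun e => v ∈ e).card)
    rw [Finset.mem_filter] at hf
    exact ⟨⟨f, hf.1⟩, hf.2⟩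
  obtain ⟨e₀, he₀⟩ := hne
  obtain ⟨i, hi⟩ := Function.ne_iff.1 (hρ e₀ he₀).1.ne_zero
  refine ⟨i, fun X u hu hX happ => ?_⟩
  have hsum_i : ∑ e : G.edges with v ∈ e.1, ρ e i = 0 := by
    have := congrFun hsum i
    rwa [Finset.sum_apply, Pi.zero_apply] at this
  have hsum_i' : ∑ e : G.edges with v ∈ e.1, -ρ e i = 0 := by
    rw [Finset.sum_neg_distrib, hsum_i, neg_zero]
  -- Balancing in coordinate `i` yields edges `e₁` and `e₂` leaving `v` on opposite sides. By
  -- valence there is a third edge `e₃`, which shares its side with one of them.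
  obtain ⟨e₁, he₁, hpos⟩ := Finset.exists_pos_of_sum_zero_of_exists_nonzero _ hsum_i
    ⟨e₀, by simpa using he₀, hi⟩
  obtain ⟨e₂, he₂, hneg⟩ := Finset.exists_pos_of_sum_zero_of_exists_nonzero _ hsum_i'
    ⟨e₀, by simpa using he₀, neg_ne_zero.2 hi⟩
  replace he₁ := (Finset.mem_filter.1 he₁).2
  replace he₂ := (Finset.mem_filter.1 he₂).2
  obtain ⟨e₃, he₃, h31, h32⟩ : ∃ e₃ : G.edges, v ∈ e₃.1 ∧ e₃ ≠ e₁ ∧ e₃ ≠ e₂ := by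
    have hlt : ({e₁.1, e₂.1} : Finset (Set (EuclideanSpace ℝ (Fin n)))).card <
        (G.edges.filter fun e => v ∈ e).card := Finset.card_le_two.trans_lt (by omega)
    obtain ⟨f, hf, hf'⟩ := Finset.exists_mem_notMem_of_card_lt_card hlt
    rw [Finset.mem_filter] at hf
    simp only [Finset.mem_insert, Finset.mem_singleton, not_or] at hf'
    exact ⟨⟨f, hf.1⟩, hf.2, fun h => hf'.1 (congrArg Subtype.val h),
      fun h => hf'.2 (congrArg Subtype.val h)⟩
  -- An integer greater than `-1 / 2` is nonnegative.
  have hui : ∀ e, 0 ≤ u e i := fun e => by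
    have h2 := hX e
    by_contra! h
    have h3 : (u e i : ℝ) ≤ -1 := by exact_mod_cast Int.le_sub_one_of_lt h
    have h4 := (abs_lt.1 (happ e)).2
    linarith
  have hleft : ∀ e : G.edges, IsLeftEnd X e.1 v → ρ e = u e := fun e h =>
    h.eq_of_pointsOutward (hu e) (hX e) (hρ e h.1).1 (hρ e h.1).2
  have hX' : ∀ e, 0 < (-X) (intVec (-u e)) := fun e => by simpa [intVec_neg] using hX e
  have hright : ∀ e : G.edges, IsLeftEnd (-X) e.1 v → ρ e = -u e := fun e h =>
    h.eq_of_pointsOutward (hu e).neg (hX' e) (hρ e h.1).1 (hρ e h.1).2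
  have hlr := fun (e : G.edges) (h : v ∈ e.1) =>
    G.isLeftEnd_or_isLeftEnd_neg e (hu e) (hX e).ne' hv h
  rcases hlr e₃ he₃ with h₃ | h₃
  · have h₁ : IsLeftEnd X e₁.1 v := (hlr e₁ he₁).resolve_right fun h => by
      have := hui e₁
      rw [hright e₁ h, Pi.neg_apply] at hpos
      omega
    obtain ⟨j, hj⟩ := G.exists_minor_ne_zero (X := X) (i := i) h31.symm he₁ he₃
      (hleft e₁ h₁ ▸ (hρ e₁ he₁).2) (hleft e₃ h₃ ▸ (hρ e₃ he₃).2)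
      (hleft e₁ h₁ ▸ hpos.ne') (hX e₁) (hX e₃)
    exact ⟨j, e₁, e₃, Or.inl ⟨h₁, h₃⟩, hj⟩
  · have h₂ : IsLeftEnd (-X) e₂.1 v := (hlr e₂ he₂).resolve_left fun h => by
      have := hui e₂
      rw [hleft e₂ h] at hneg
      omega
    obtain ⟨j, hj⟩ := G.exists_minor_ne_zero (X := -X) (i := i) h32.symm he₂ he₃
      (hright e₂ h₂ ▸ (hρ e₂ he₂).2) (hright e₃ h₃ ▸ (hρ e₃ he₃).2)
      (hright e₂ h₂ ▸ fun h => by omega) (hX' e₂) (hX' e₃)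
    refine ⟨j, e₂, e₃, Or.inr ⟨h₂, h₃⟩, ?_⟩
    simpa only [Pi.neg_apply, neg_mul_neg] using hj

open scoped Classical in
/-- The number of vertices in a ball is bounded in terms of the total weight of the edges that
meet its boundary. -/
theorem card_vertices_ball_le {c : EuclideanSpace ℝ (Fin n)} {r : ℝ}
    (hU : Metric.closedBall c r ⊆ U) :
    ((G.vertices.filter (· ∈ Metric.ball c r)).card : ℝ) ≤ 10 * n ^ 2 *
      (∑ e : G.edges,
        (if (e.1 ∩ Metric.sphere c r).Nonempty then (G.weight e).norm else 0)) ^ 2 := by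
  set V := G.vertices.filter (· ∈ Metric.ball c r) with hV
  set H : G.edges → ℝ := fun e =>
    if (e.1 ∩ Metric.sphere c r).Nonempty then (G.weight e).norm else 0 with hH
  have hchoice : ∀ i : Fin n, ∃ (X : EuclideanSpace ℝ (Fin n) →L[ℝ] ℝ)
      (u : G.edges → Fin n → ℤ), (∀ e, (G.weight e).IsRep (u e)) ∧
      (∀ e, 0 < X (intVec (u e))) ∧ Set.InjOn X G.vertices ∧
      (∀ e, |X (intVec (u e)) - u e i| < 1 / 2) ∧
      ∀ e e' j, |(X (intVec (u e)) * u e' j - X (intVec (u e')) * u e j) -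
        ((u e i : ℝ) * u e' j - u e' i * u e j)| < 1 / 2 := by
    intro i
    set W : Set (Fin n → ℤ) := ⋃ e, {u | (G.weight e).IsRep u} with hW
    have hWfin : W.Finite := Set.finite_iUnion fun e => (G.weight e).finite_isRep
    -- Genericity is needed twice: no edge may be vertical, and distinct vertices need distinct
    -- abscissas.
    set D : Set (EuclideanSpace ℝ (Fin n)) :=
      intVec '' W ∪ ((fun x : EuclideanSpace ℝ (Fin n) × EuclideanSpace ℝ (Fin n) => x.1 - x.2) ''
        (G.vertices ×ˢ G.vertices : Set _) \ {0}) with hD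
    have hDfin : D.Finite := (hWfin.image _).union
      (((G.vertices.finite_toSet.prod G.vertices.finite_toSet).image _).sdiff)
    have hD0 : ∀ d ∈ D, d ≠ 0 := by
      rintro d (⟨u, hu, rfl⟩ | hd)
      · obtain ⟨e, he⟩ := Set.mem_iUnion.1 hu
        exact intVec_ne_zero (Weight.IsRep.ne_zero he)
      · exact hd.2
    have hs1 : ∀ᶠ X : EuclideanSpace ℝ (Fin n) →L[ℝ] ℝ in 𝓝 (EuclideanSpace.proj i),
        ∀ u ∈ W, |X (intVec u) - u i| < 1 / 2 := by
      rw [hWfin.eventually_all]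
      intro u _
      refine ContinuousAt.eventually_lt (by fun_prop) continuousAt_const ?_
      simp
    have hs2 : ∀ᶠ X : EuclideanSpace ℝ (Fin n) →L[ℝ] ℝ in 𝓝 (EuclideanSpace.proj i),
        ∀ u ∈ W, ∀ u' ∈ W, ∀ j, |(X (intVec u) * u' j - X (intVec u') * u j) -
          ((u i : ℝ) * u' j - u' i * u j)| < 1 / 2 := by
      rw [hWfin.eventually_all]
      intro u _
      rw [hWfin.eventually_all]
      intro u' _
      rw [Filter.eventually_all]
      intro j
      refine ContinuousAt.eventually_lt (by fun_prop) continuousAt_const ?_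
      simp
    obtain ⟨X, ⟨hX1, hX2⟩, hXD⟩ := exists_generic_functional D hDfin hD0 _ (hs1.and hs2)
    have hrep : ∀ e : G.edges, ∃ u, (G.weight e).IsRep u ∧ 0 < X (intVec u) := by
      intro e
      obtain ⟨u, hu⟩ := (G.weight e).exists_isRep
      have hne : X (intVec u) ≠ 0 :=
        hXD _ (Or.inl ⟨u, Set.mem_iUnion.2 ⟨e, hu⟩, rfl⟩)
      rcases hne.lt_or_gt with h | h
      · exact ⟨-u, hu.neg, by rw [intVec_neg, map_neg]; linarith⟩
      · exact ⟨u, hu, h⟩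
    choose u hu hXu using hrep
    have huW : ∀ e, u e ∈ W := fun e => Set.mem_iUnion.2 ⟨e, hu e⟩
    refine ⟨X, u, hu, hXu, fun x hx y hy hxy => ?_, fun e => hX1 _ (huW e),
      fun e e' j => hX2 _ (huW e) _ (huW e') j⟩
    by_contra hne
    refine hXD (x - y) (Or.inr ⟨⟨(x, y), ⟨hx, hy⟩, rfl⟩, sub_ne_zero.2 hne⟩) ?_
    rw [map_sub, hxy, sub_self]
  choose X u hu hX hinj happ hdet using hchoice
  set d : Fin n → Fin n → G.edges → G.edges → ℝ := fun i j e e' =>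
    X i (intVec (u i e)) * u i e' j - X i (intVec (u i e')) * u i e j with hd
  set M : Fin n → Fin n → EuclideanSpace ℝ (Fin n) → G.edges → G.edges → ℝ := fun i j v e e' =>
    (if IsLeftEnd (X i) e.1 v ∧ IsLeftEnd (X i) e'.1 v then |d i j e e'| else 0) +
      (if IsLeftEnd (-X i) e.1 v ∧ IsLeftEnd (-X i) e'.1 v then |d i j e e'| else 0) with hM
  have hM0 : ∀ i j v e e', 0 ≤ M i j v e e' := fun i j v e e' => by
    simp only [hM]; positivity
  have hlow : ∀ v ∈ V, 1 / 2 ≤ ∑ i, ∑ j, ∑ e, ∑ e', M i j v e e' := by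
    intro v hv
    obtain ⟨i, hi⟩ := G.exists_independent_edges (Finset.mem_filter.1 hv).1
    obtain ⟨j, e, e', hside, hne⟩ := hi (X i) (u i) (hu i) (hX i) (happ i)
    have h1 : (1 : ℝ) ≤ |(u i e i : ℝ) * u i e' j - u i e' i * u i e j| := by
      exact_mod_cast Int.one_le_abs hne
    have h2 : 1 / 2 ≤ |d i j e e'| := by
      have h3 := hdet i e e' j
      have h4 := abs_sub_abs_le_abs_sub ((u i e i : ℝ) * u i e' j - u i e' i * u i e j)
        (d i j e e')
      rw [abs_sub_comm] at h3
      linarith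
    have h3 : |d i j e e'| ≤ M i j v e e' := by
      have h0 := abs_nonneg (d i j e e')
      simp only [hM]
      rcases hside with h | h
      · rw [if_pos h]; split_ifs <;> linarith
      · rw [if_pos h]; split_ifs <;> linarith
    calc 1 / 2 ≤ M i j v e e' := h2.trans h3
      _ ≤ ∑ e', M i j v e e' :=
        Finset.single_le_sum (fun e' _ => hM0 i j v e e') (Finset.mem_univ e')
      _ ≤ ∑ e, ∑ e', M i j v e e' :=
        Finset.single_le_sum (f := fun e => ∑ e', M i j v e e')
          (fun e _ => Finset.sum_nonneg fun e' _ => hM0 i j v e e') (Finset.mem_univ e)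
      _ ≤ ∑ j, ∑ e, ∑ e', M i j v e e' :=
        Finset.single_le_sum (f := fun j => ∑ e, ∑ e', M i j v e e')
          (fun j _ => Finset.sum_nonneg fun e _ => Finset.sum_nonneg fun e' _ => hM0 i j v e e')
          (Finset.mem_univ j)
      _ ≤ _ := Finset.single_le_sum (f := fun i => ∑ j, ∑ e, ∑ e', M i j v e e')
          (fun i _ => Finset.sum_nonneg fun j _ => Finset.sum_nonneg fun e _ =>
            Finset.sum_nonneg fun e' _ => hM0 i j v e e') (Finset.mem_univ i)
  -- For edges meeting the sphere, the integer minor is at most twice the product of the norms. The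
  -- perturbation costs `1 / 2`, and norms are at least 1, so `2 * |d|` is at most `2 * (2 + 1 / 2)
  -- = 5` times the product.
  have hup : ∀ i j, ∑ v ∈ V, ∑ e, ∑ e', M i j v e e' ≤ 5 * (∑ e, H e) ^ 2 := by
    intro i j
    refine (G.sum_det_vertices_le j hU (hu i) (hX i) (hinj i)).trans ?_
    rw [sq, Finset.sum_mul_sum, Finset.mul_sum]
    refine Finset.sum_le_sum fun e _ => ?_
    rw [Finset.mul_sum]
    refine Finset.sum_le_sum fun e' _ => ?_
    simp only [hH]
    by_cases he : (e.1 ∩ Metric.sphere c r).Nonempty <;>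
      by_cases he' : (e'.1 ∩ Metric.sphere c r).Nonempty
    · rw [if_pos ⟨he, he'⟩, if_pos he, if_pos he', (hu i e).norm_eq, (hu i e').norm_eq]
      have h1 := one_le_norm_intVec (hu i e).ne_zero
      have h2 := one_le_norm_intVec (hu i e').ne_zero
      have h3 := abs_sub_abs_le_abs_sub (d i j e e')
        ((u i e i : ℝ) * u i e' j - u i e' i * u i e j)
      have h4 := (hdet i e e' j).le
      have h5 := abs_sub ((u i e i : ℝ) * u i e' j) (u i e' i * u i e j)
      rw [abs_mul, abs_mul] at h5
      have h6 : |(u i e i : ℝ)| * |(u i e' j : ℝ)| ≤ ‖intVec (u i e)‖ * ‖intVec (u i e')‖ :=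
        mul_le_mul (abs_apply_le_norm_intVec _ _) (abs_apply_le_norm_intVec _ _) (abs_nonneg _)
          (norm_nonneg _)
      have h7 : |(u i e' i : ℝ)| * |(u i e j : ℝ)| ≤ ‖intVec (u i e')‖ * ‖intVec (u i e)‖ :=
        mul_le_mul (abs_apply_le_norm_intVec _ _) (abs_apply_le_norm_intVec _ _) (abs_nonneg _)
          (norm_nonneg _)
      have h8 : 1 ≤ ‖intVec (u i e)‖ * ‖intVec (u i e')‖ := one_le_mul_of_one_le_of_one_le h1 h2
      change 2 * |d i j e e'| ≤ _
      linarith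
    · simp [he']
    · simp [he]
    · simp [he]
  have hsum : (V.card : ℝ) * (1 / 2) ≤ n * (n * (5 * (∑ e, H e) ^ 2)) := by
    calc (V.card : ℝ) * (1 / 2) = ∑ v ∈ V, (1 / 2 : ℝ) := by rw [Finset.sum_const, nsmul_eq_mul]
      _ ≤ ∑ v ∈ V, ∑ i, ∑ j, ∑ e, ∑ e', M i j v e e' := Finset.sum_le_sum hlow
      _ = ∑ i, ∑ j, ∑ v ∈ V, ∑ e, ∑ e', M i j v e e' := by
        rw [Finset.sum_comm]
        exact Finset.sum_congr rfl fun i _ => Finset.sum_comm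
      _ ≤ ∑ _i : Fin n, ∑ _j : Fin n, 5 * (∑ e, H e) ^ 2 :=
        Finset.sum_le_sum fun i _ => Finset.sum_le_sum fun j _ => hup i j
      _ = _ := by simp
  linarith

end TropicalCurve

/-! ### Covering the compact set -/

theorem mainTheorem1 (n : ℕ) (hn : 2 ≤ n) (A : ℝ) (hA : 0 < A)
    (U : Set (EuclideanSpace ℝ (Fin n))) (hU : IsOpen U)
    (K : Set (EuclideanSpace ℝ (Fin n))) (hK : IsCompact K) (hKU : K ⊆ U) :
    ∃ N : ℕ, ∀ G : TropicalCurve U, G.area ≤ ENNReal.ofReal A →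
      ((G.vertices : Set (EuclideanSpace ℝ (Fin n))) ∩ K).ncard ≤ N := by
  classical
  have hloc : ∀ x ∈ K, ∃ R > 0, Metric.closedBall x R ⊆ U := fun x hx =>
    Metric.nhds_basis_closedBall.mem_iff.1 (hU.mem_nhds (hKU hx))
  choose! R hR hRU using hloc
  -- Balls of half radius are used because the good radius `r` is only known to lie between `R x /
  -- 2` and `R x`.
  obtain ⟨T, hTK, hTcov⟩ := hK.elim_nhds_subcover (fun x => Metric.ball x (R x / 2))
    fun x hx => Metric.ball_mem_nhds x (half_pos (hR x hx))
  refine ⟨∑ x ∈ T, ⌊10 * (n : ℝ) ^ 2 * (4 * A / R x) ^ 2⌋₊, fun G hG => ?_⟩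
  have hcover : (G.vertices : Set (EuclideanSpace ℝ (Fin n))) ∩ K ⊆
      (T.biUnion fun x => G.vertices.filter (· ∈ Metric.ball x (R x / 2)) :
        Finset (EuclideanSpace ℝ (Fin n))) := by
    rintro v ⟨hv, hvK⟩
    obtain ⟨x, hxT, hvx⟩ := Set.mem_iUnion₂.1 (hTcov hvK)
    exact Finset.mem_coe.2 (Finset.mem_biUnion.2 ⟨x, hxT, Finset.mem_filter.2 ⟨hv, hvx⟩⟩)
  refine (Set.ncard_le_ncard hcover (Finset.finite_toSet _)).trans ?_
  rw [Set.ncard_coe_finset]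
  refine Finset.card_biUnion_le.trans (Finset.sum_le_sum fun x hx => Nat.le_floor ?_)
  have hRx := hR x (hTK x hx)
  obtain ⟨r, hr, hsum⟩ := G.exists_radius_sum_norm_le x hRx hA hG
  calc ((G.vertices.filter (· ∈ Metric.ball x (R x / 2))).card : ℝ)
      ≤ ((G.vertices.filter (· ∈ Metric.ball x r)).card : ℝ) := by
        exact_mod_cast Finset.card_le_card <| Finset.monotone_filter_right _ fun v _ hv =>
          Metric.ball_subset_ball (x := x) hr.1.le hv
    _ ≤ _ := G.card_vertices_ball_le
        ((Metric.closedBall_subset_closedBall hr.2.le).trans (hRU x (hTK x hx)))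
    _ ≤ _ := by
        gcongr
        refine Finset.sum_nonneg fun e _ => ?_
        split_ifs
        · exact (G.weight e).norm_nonneg
        · exact le_rfl
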